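/- Let $n\ge 1$, let $(q_j)_{j\in\mathbb N}$ be an infinite sequence of positive integers and let $\tau=(\tau_1,\dots,\tau_n)$ be an $n$-tuple of positive real numbers. Suppose that the limit $$\lim_{j\to\infty}\frac{\log q_j}{\log q_{j-1}}=k$$ exists, with $1<k<\infty$, and that $\max_{1\le i\le n}\tau_i<k-1$. Let $\|y\|$ denote the distance from the real number $y$ to the nearest integer, and let $\dim_H$ denote the Hausdorff dimension. Then $$\dim_H\left\{x=(x_1,\dots,x_n)\in[0,1]^n:\ \|q_jx_i\|<q_j^{-\tau_i}\ (1\le i\le n)\ \text{for all sufficiently large } j\in\mathbb N\right\}=\min_{1\le j\le n}\frac{n-\frac1{k-1}\sum_{i=1}^n\tau_i+\sum_{i:\,\tau_j>\tau_i}(\tau_j-\tau_i)}{\tau_j+1}.$$ -/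

import Mathlib

open Filter Topology

/-- The distance `‖x‖` from a real number `x` to the nearest integer. -/
noncomputable def distNearestInt (x : ℝ) : ℝ := |x - round x|

/-- The set of `x ∈ [0,1]^n` such that, for all sufficiently large `j`,
`‖q_j x_i‖ < q_j ^ (-τ_i)` for every coordinate `i`. The ambient space `Fin n → ℝ` carries the
maximum norm. -/
def liminfApproxSet {n : ℕ} (q : ℕ → ℕ) (τ : Fin n → ℝ) : Set (Fin n → ℝ) :=
  {x | (∀ i, x i ∈ Set.Icc (0 : ℝ) 1) ∧
    ∀ᶠ j in atTop, ∀ i, distNearestInt ((q j : ℝ) * x i) < (q j : ℝ) ^ (-τ i)}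

/-! The liminf set is a countable union of sets on which the inequalities hold for every index of a
tail `Q` of `q`, so it suffices to treat such a tail. One coordinate then lives on a Cantor set. An
interval of length about `Q J ^ (-1 - τ i)` around a fraction with denominator `Q J` contains about
`Q (J + 1) * Q J ^ (-1 - τ i)` fractions with denominator `Q (J + 1)`. Since `log (Q (J + 1)) / log
(Q J) → k`, the number of level `J` intervals is `Q J ^ (1 - τ i / (k - 1) + o(1))`
(`tendsto_log_growthProd_div`).

Upper bound (`dimH_le_of_forall_distNearestInt`): cover by cubes of radius `Q J ^ (-1 - τ l)`.
Coordinate `i` costs an extra factor `Q J ^ max (τ l - τ i) 0`, and each `l` gives one of the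
quotients in the minimum.

Lower bound (`le_dimH_of_forall_distNearestInt`): take the product of uniform measures on the
coordinate Cantor sets. For `r = Q J ^ (-1 - t)` between `1 / Q (J + 1)` and `1 / Q J`, a ball of
radius `r` has mass at most about `Q J` to the power `-∑ (1 - τ i / (k - 1)) - ∑ max (t - τ i) 0`.
Comparison with `r ^ s` is an inequality in `t` that need only be checked at the `τ j`
(`mul_one_add_le_of_breakpoints`), where it is the formula again; the mass distribution principle
concludes. -/

open MeasureTheory Measure

/-! ### Growth of the interval counts -/

/-- The product of the quantities `c * Q (j + 1) * Q j ^ (-1 - t)` for `j < J`: up to the constant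
`c`, the number of level `J` intervals in one coordinate. -/
noncomputable def growthProd (Q : ℕ → ℕ) (t c : ℝ) (J : ℕ) : ℝ :=
  ∏ j ∈ Finset.range J, c * ((Q (j + 1) : ℝ) * (Q j : ℝ) ^ (-1 - t))

theorem growthProd_succ (Q : ℕ → ℕ) (t c : ℝ) (J : ℕ) :
    growthProd Q t c (J + 1) =
      growthProd Q t c J * (c * ((Q (J + 1) : ℝ) * (Q J : ℝ) ^ (-1 - t))) :=
  Finset.prod_range_succ _ _

theorem growthProd_pos {Q : ℕ → ℕ} (hQ : ∀ j, 2 ≤ Q j) (t : ℝ) {c : ℝ} (hc : 0 < c) (J : ℕ) :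
    0 < growthProd Q t c J := by
  refine Finset.prod_pos fun j _ => ?_
  have h1 : (0 : ℝ) < Q j := by exact_mod_cast (by have := hQ j; omega : 0 < Q j)
  have h2 : (0 : ℝ) < Q (j + 1) := by exact_mod_cast (by have := hQ (j + 1); omega : 0 < Q (j + 1))
  positivity

/-- Once `v j < (c - 1) * (ε / 2)`, the level `ε / 2` is stable under the recursion and any excess
over it shrinks by `c⁻¹` at each step. -/
theorem tendsto_zero_of_contraction {e v : ℕ → ℝ} {c : ℝ} (hc : 1 < c) (he : ∀ j, 0 ≤ e j)
    (hv : Tendsto v atTop (𝓝 0)) (h : ∀ᶠ j in atTop, c * e (j + 1) ≤ e j + v j) :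
    Tendsto e atTop (𝓝 0) := by
  have hc0 : 0 < c := by linarith
  rw [Metric.tendsto_atTop]
  intro ε hε
  have hδ : 0 < (c - 1) * (ε / 2) := by have := sub_pos.2 hc; positivity
  obtain ⟨N, hN⟩ := eventually_atTop.1 (h.and (hv.eventually (gt_mem_nhds hδ)))
  have key : ∀ m, e (N + m) ≤ ε / 2 + e N * c⁻¹ ^ m := by
    intro m
    induction m with
    | zero => simp; linarith
    | succ m ih =>
      obtain ⟨h1, h2⟩ := hN (N + m) (by omega)
      have h3 : c * e (N + (m + 1)) ≤ c * (ε / 2 + e N * c⁻¹ ^ (m + 1)) := by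
        have : c * (ε / 2 + e N * c⁻¹ ^ (m + 1)) = c * (ε / 2) + e N * c⁻¹ ^ m := by
          rw [pow_succ]; field_simp
        rw [this, ← add_assoc]
        nlinarith
      exact le_of_mul_le_mul_left h3 hc0
  have h0 : Tendsto (fun m : ℕ => e N * c⁻¹ ^ m) atTop (𝓝 0) := by
    simpa using (tendsto_pow_atTop_nhds_zero_of_lt_one (by positivity)
      (inv_lt_one_of_one_lt₀ hc)).const_mul (e N)
  obtain ⟨M, hM⟩ := eventually_atTop.1 (h0.eventually (gt_mem_nhds (half_pos hε)))
  refine ⟨N + M, fun j hj => ?_⟩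
  obtain ⟨m, rfl⟩ := Nat.exists_eq_add_of_le (show N ≤ j by omega)
  rw [Real.dist_eq, sub_zero, abs_of_nonneg (he _)]
  linarith [key m, hM m (by omega)]

/-- The limit `L` is the fixed point of `L * k = L + u₀`. The error `b j - L` is divided by `ρ j`,
eventually above `(1 + k) / 2 > 1`, up to a vanishing term. -/
theorem tendsto_of_affine_recursion {b ρ u : ℕ → ℝ} {k u₀ : ℝ} (hk : 1 < k)
    (hρ : Tendsto ρ atTop (𝓝 k)) (hu : Tendsto u atTop (𝓝 u₀))
    (h : ∀ j, b (j + 1) * ρ j = b j + u j) : Tendsto b atTop (𝓝 (u₀ / (k - 1))) := by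
  set L := u₀ / (k - 1) with hL
  have hLk : u₀ + L - L * k = 0 := by
    have : k - 1 ≠ 0 := by linarith
    rw [hL]; field_simp; ring
  have hv : Tendsto (fun j => |u j + L - L * ρ j|) atTop (𝓝 0) := by
    have := ((hu.add_const L).sub (hρ.const_mul L)).abs
    rwa [hLk, abs_zero] at this
  have := tendsto_zero_of_contraction (e := fun j => |b j - L|) (c := (1 + k) / 2) (by linarith)
    (fun j => abs_nonneg _) hv ?_
  · have h2 := (tendsto_zero_iff_abs_tendsto_zero _).2 this
    simpa using h2.add_const L
  · filter_upwards [hρ.eventually (lt_mem_nhds (show (1 + k) / 2 < k by linarith))] with j hj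
    have h1 : (b (j + 1) - L) * ρ j = (b j - L) + (u j + L - L * ρ j) := by
      linear_combination h j
    calc (1 + k) / 2 * |b (j + 1) - L| ≤ ρ j * |b (j + 1) - L| := by gcongr
      _ = |(b (j + 1) - L) * ρ j| := by
        rw [abs_mul, abs_of_pos (show 0 < ρ j by linarith), mul_comm]
      _ ≤ _ := by rw [h1]; exact abs_add_le _ _

theorem two_mul_le_of_growth {Q : ℕ → ℕ} {t : ℝ} (ht : 0 < t) (hQ : ∀ j, 2 ≤ Q j)
    (hg : ∀ j, 12 ≤ (Q (j + 1) : ℝ) * (Q j : ℝ) ^ (-1 - t)) (j : ℕ) :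
    2 * (Q j : ℝ) ≤ Q (j + 1) := by
  have h2 : (2 : ℝ) ≤ Q j := by exact_mod_cast hQ j
  have h1 : (Q j : ℝ) ^ (-1 - t) ≤ (Q j : ℝ)⁻¹ := by
    rw [← Real.rpow_neg_one]
    exact Real.rpow_le_rpow_of_exponent_le (by linarith) (by linarith)
  have h3 : 12 ≤ (Q (j + 1) : ℝ) * (Q j : ℝ)⁻¹ :=
    (hg j).trans (by gcongr)
  rw [← div_eq_mul_inv, le_div_iff₀ (by linarith)] at h3
  linarith

theorem tendsto_natCast_atTop_of_two_mul_le {Q : ℕ → ℕ} (hQ : ∀ j, 2 ≤ Q j)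
    (h : ∀ j, 2 * (Q j : ℝ) ≤ Q (j + 1)) : Tendsto (fun j => (Q j : ℝ)) atTop atTop :=
  tendsto_atTop_of_geom_le (by exact_mod_cast (by have := hQ 0; omega : 0 < Q 0)) one_lt_two h

/-- The logarithm of the product recursion, divided by `log (Q J)`, is an affine recursion with `u₀
= k - 1 - t`; the constant `c` disappears because `log (Q J) → ∞`. -/
theorem tendsto_log_growthProd_div {Q : ℕ → ℕ} {t c k : ℝ} (hk : 1 < k) (hc : 0 < c)
    (hQ : ∀ j, 2 ≤ Q j) (hQt : Tendsto (fun j => (Q j : ℝ)) atTop atTop)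
    (hlim : Tendsto (fun j => Real.log (Q (j + 1)) / Real.log (Q j)) atTop (𝓝 k)) :
    Tendsto (fun J => Real.log (growthProd Q t c J) / Real.log (Q J)) atTop
      (𝓝 (1 - t / (k - 1))) := by
  have hQ1 : ∀ j, (1 : ℝ) < Q j := fun j => by exact_mod_cast hQ j
  have hlog : ∀ j, 0 < Real.log (Q j) := fun j => Real.log_pos (hQ1 j)
  have hu : Tendsto (fun j => Real.log c / Real.log (Q j) +
      (Real.log (Q (j + 1)) / Real.log (Q j) + (-1 - t))) atTop (𝓝 (0 + (k + (-1 - t)))) :=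
    ((Real.tendsto_log_atTop.comp hQt).const_div_atTop _).add (hlim.add_const _)
  have := tendsto_of_affine_recursion (b := fun J => Real.log (growthProd Q t c J) / Real.log (Q J))
    hk hlim hu ?_
  · convert this using 2
    have : k - 1 ≠ 0 := by linarith
    field_simp
    ring
  · intro j
    have h0 : (0 : ℝ) < Q j := by linarith [hQ1 j]
    have h1 : (0 : ℝ) < Q (j + 1) := by linarith [hQ1 (j + 1)]
    have hp := Real.rpow_pos_of_pos h0 (-1 - t)
    rw [growthProd_succ, Real.log_mul (growthProd_pos hQ t hc j).ne' (by positivity),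
      Real.log_mul hc.ne' (by positivity), Real.log_mul h1.ne' hp.ne', Real.log_rpow h0]
    have := (hlog j).ne'
    have := (hlog (j + 1)).ne'
    field_simp

theorem eventually_rpow_le_growthProd {Q : ℕ → ℕ} {t c k η : ℝ} (hk : 1 < k) (hc : 0 < c)
    (hη : 0 < η) (hQ : ∀ j, 2 ≤ Q j) (hQt : Tendsto (fun j => (Q j : ℝ)) atTop atTop)
    (hlim : Tendsto (fun j => Real.log (Q (j + 1)) / Real.log (Q j)) atTop (𝓝 k)) :
    ∀ᶠ J in atTop, (Q J : ℝ) ^ (1 - t / (k - 1) - η) ≤ growthProd Q t c J := by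
  filter_upwards [(tendsto_log_growthProd_div (t := t) hk hc hQ hQt hlim).eventually
    (lt_mem_nhds (sub_lt_self _ hη))] with J hJ
  have h1 : (1 : ℝ) < Q J := by exact_mod_cast hQ J
  rw [lt_div_iff₀ (Real.log_pos h1)] at hJ
  rw [← Real.log_le_log_iff (by positivity) (growthProd_pos hQ t hc J),
    Real.log_rpow (by positivity)]
  exact hJ.le

theorem eventually_growthProd_le_rpow {Q : ℕ → ℕ} {t c k η : ℝ} (hk : 1 < k) (hc : 0 < c)
    (hη : 0 < η) (hQ : ∀ j, 2 ≤ Q j) (hQt : Tendsto (fun j => (Q j : ℝ)) atTop atTop)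
    (hlim : Tendsto (fun j => Real.log (Q (j + 1)) / Real.log (Q j)) atTop (𝓝 k)) :
    ∀ᶠ J in atTop, growthProd Q t c J ≤ (Q J : ℝ) ^ (1 - t / (k - 1) + η) := by
  filter_upwards [(tendsto_log_growthProd_div (t := t) hk hc hQ hQt hlim).eventually
    (gt_mem_nhds (lt_add_of_pos_right _ hη))] with J hJ
  have h1 : (1 : ℝ) < Q J := by exact_mod_cast hQ J
  rw [div_lt_iff₀ (Real.log_pos h1)] at hJ
  rw [← Real.log_le_log_iff (growthProd_pos hQ t hc J) (by positivity),
    Real.log_rpow (by positivity)]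
  exact hJ.le

theorem exists_growth_tail {n : ℕ} {q : ℕ → ℕ} {τ : Fin n → ℝ} {k : ℝ} (hk : 1 < k)
    (hq : ∀ j, 0 < q j)
    (hlim : Tendsto (fun j => Real.log (q (j + 1)) / Real.log (q j)) atTop (𝓝 k))
    (hτk : ∀ i, τ i < k - 1) :
    ∃ N, ∀ j, 2 ≤ q (N + j) ∧
      ∀ i, 12 ≤ (q (N + j + 1) : ℝ) * (q (N + j) : ℝ) ^ (-1 - τ i) := by
  obtain ⟨N, hN⟩ := eventually_atTop.1
    (hlim.eventually (lt_mem_nhds (show (1 + k) / 2 < k by linarith)))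
  have hnn : ∀ j, 0 ≤ Real.log (q j) := fun j => Real.log_natCast_nonneg _
  have hpos : ∀ j ≥ N, 0 < Real.log (q j) := by
    intro j hj
    refine (hnn j).lt_of_ne fun h0 => ?_
    -- A zero logarithm in the denominator would make the quotient `0` by convention, below `(1 + k)
    -- / 2`.
    have := hN j hj
    rw [← h0, div_zero] at this
    linarith
  have htop : Tendsto (fun j => Real.log (q j)) atTop atTop := by
    rw [← tendsto_add_atTop_iff_nat N]
    refine tendsto_atTop_of_geom_le (c := (1 + k) / 2) (hpos _ (by omega)) (by linarith) fun j => ?_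
    have := hN (j + N) (by omega)
    rw [lt_div_iff₀ (hpos _ (by omega))] at this
    rw [show j + 1 + N = j + N + 1 by omega]
    exact this.le
  have h2 : ∀ᶠ j in atTop, 2 ≤ q j := by
    filter_upwards [eventually_ge_atTop N] with j hj
    by_contra hlt
    have h1 : q j = 1 := by have := hq j; omega
    have := hpos j hj
    simp [h1] at this
  have h12 : ∀ᶠ j in atTop, ∀ i, 12 ≤ (q (j + 1) : ℝ) * (q j : ℝ) ^ (-1 - τ i) := by
    rw [eventually_all]
    intro i
    -- Half of the gap `k - 1 - τ i` is kept as a surplus exponent, and `q j ^ η` eventually exceeds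
    -- `12`.
    set η := (k - 1 - τ i) / 2 with hη
    have hη0 : 0 < η := by have := hτk i; rw [hη]; linarith
    filter_upwards [hlim.eventually (lt_mem_nhds (show 1 + τ i + η < k by linarith [hτk i])),
      (htop.const_mul_atTop hη0).eventually_ge_atTop (Real.log 12), eventually_ge_atTop N]
      with j h1 h2 h3
    rw [lt_div_iff₀ (hpos j h3)] at h1
    have hj : (0 : ℝ) < q j := by exact_mod_cast hq j
    have hj1 : (0 : ℝ) < q (j + 1) := by exact_mod_cast hq (j + 1)
    have hp := Real.rpow_pos_of_pos hj (-1 - τ i)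
    rw [← Real.log_le_log_iff (by norm_num) (by positivity), Real.log_mul hj1.ne' hp.ne',
      Real.log_rpow hj]
    linarith
  obtain ⟨M, hM⟩ := eventually_atTop.1 (h2.and h12)
  exact ⟨M, fun j => hM (M + j) (by omega)⟩

/-! ### Reduction to break points -/

/-- The function `t ↦ n - S / (k - 1) + ∑ (t - τ i)⁺ - s (1 + t)` is convex and piecewise linear
with break points `τ i`, so it is nonnegative on `[0, ∞)` when it is so at the break points. -/
theorem mul_one_add_le_of_breakpoints {n : ℕ} [NeZero n] {τ : Fin n → ℝ} {A s t : ℝ}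
    (hs : 0 ≤ s) (hsn : s ≤ n)
    (h : ∀ j, s * (1 + τ j) ≤ A + ∑ i, max (τ j - τ i) 0) :
    s * (1 + t) ≤ A + ∑ i, max (t - τ i) 0 := by
  classical
  -- The slope immediately to the right of `t` is `c - s`; its sign decides which neighbouring break
  -- point to compare with.
  set c : ℕ := (Finset.univ.filter fun i => τ i ≤ t).card with hc
  have hsum : ∀ a b : ℝ, (∑ i, if τ i ≤ t then a - b else 0) = c * (a - b) := by
    intro a b
    rw [← Finset.sum_filter, Finset.sum_const, nsmul_eq_mul, hc]
  by_cases hcase : s ≤ c ∧ 0 < c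
  · obtain ⟨hsc, hc0⟩ := hcase
    obtain ⟨j, hj, hmax⟩ := Finset.exists_max_image (Finset.univ.filter fun i => τ i ≤ t) τ
      (Finset.card_pos.1 hc0)
    simp only [Finset.mem_filter, Finset.mem_univ, true_and] at hj hmax
    have h1 : ∑ i, max (τ j - τ i) 0 + c * (t - τ j) ≤ ∑ i, max (t - τ i) 0 := by
      rw [← hsum, ← Finset.sum_add_distrib]
      refine Finset.sum_le_sum fun i _ => ?_
      split_ifs with hi
      · rw [max_eq_left (by linarith [hmax i hi])]
        exact le_max_of_le_left (by linarith)
      · rw [max_eq_right (by push Not at hi; linarith), zero_add]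
        exact le_max_right _ _
    nlinarith [h j]
  -- The slope is now nonpositive, so the next break point to the right serves; it exists because `c
  -- = n` would give `s ≤ c`.
  · have hne : (Finset.univ.filter fun i => t < τ i).Nonempty := by
      by_contra hemp
      rw [Finset.not_nonempty_iff_eq_empty, Finset.filter_eq_empty_iff] at hemp
      have hcn : c = n := by
        rw [hc, Finset.filter_true_of_mem fun i hi => not_lt.1 (hemp hi), Finset.card_univ,
          Fintype.card_fin]
      exact hcase ⟨hcn ▸ hsn, hcn ▸ Nat.pos_of_neZero n⟩
    obtain ⟨j, hj, hmin⟩ := Finset.exists_min_image _ τ hne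
    simp only [Finset.mem_filter, Finset.mem_univ, true_and] at hj hmin
    have hcs : (c : ℝ) ≤ s := by
      rcases Nat.eq_zero_or_pos c with h0 | h0
      · simpa [h0] using hs
      · exact le_of_not_ge fun h' => hcase ⟨h', h0⟩
    have h1 : ∑ i, max (τ j - τ i) 0 ≤ ∑ i, max (t - τ i) 0 + c * (τ j - t) := by
      rw [← hsum, ← Finset.sum_add_distrib]
      refine Finset.sum_le_sum fun i _ => ?_
      split_ifs with hi
      · rw [max_eq_left (by linarith), max_eq_left (by linarith)]
        linarith
      · push Not at hi
        rw [max_eq_right (by linarith [hmin i hi]), add_zero]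
        exact le_max_right _ _
    nlinarith [h j]

/-! ### Upper bound by coverings -/

/-- The nearest fraction at level `J + 1` lies within `l + l'` of the one at level `J`, so each
numerator has at most `2 * Q (J + 1) * (l + l') + 1` successors. As `Q (J + 1) * l' ≤ 1` and `Q (J +
1) * l ≥ 12`, this is at most `5 * Q (J + 1) * l`. -/
theorem exists_finset_int_near {F : Set ℝ} {Q : ℕ → ℕ} {t : ℝ} (ht : 0 < t) (hQ : ∀ j, 2 ≤ Q j)
    (hg : ∀ j, 12 ≤ (Q (j + 1) : ℝ) * (Q j : ℝ) ^ (-1 - t)) (hF : F ⊆ Set.Icc 0 1)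
    (hFQ : ∀ x ∈ F, ∀ j, distNearestInt ((Q j : ℝ) * x) < (Q j : ℝ) ^ (-t)) (J : ℕ) :
    ∃ A : Finset ℤ, (A.card : ℝ) ≤ (Q 0 + 3) * growthProd Q t 5 J ∧
      ∀ x ∈ F, ∃ p ∈ A, |x - p / Q J| ≤ (Q J : ℝ) ^ (-1 - t) := by
  classical
  have hpos : ∀ j, (0 : ℝ) < Q j := fun j => by
    exact_mod_cast (by have := hQ j; omega : 0 < Q j)
  have near : ∀ x ∈ F, ∀ j, |x - (round ((Q j : ℝ) * x) : ℝ) / Q j| ≤ (Q j : ℝ) ^ (-1 - t) := by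
    intro x hx j
    have h1 := (hFQ x hx j).le
    have h2 : x - (round ((Q j : ℝ) * x) : ℝ) / Q j =
        ((Q j : ℝ) * x - round ((Q j : ℝ) * x)) * (Q j : ℝ)⁻¹ := by
      have := (hpos j).ne'
      field_simp
    rw [h2, abs_mul, abs_of_pos (inv_pos.2 (hpos j)), show -1 - t = -t + -1 by ring,
      Real.rpow_add (hpos j), Real.rpow_neg_one]
    have := (hpos j).le
    exact mul_le_mul_of_nonneg_right h1 (by positivity)
  induction J with
  | zero =>
    refine ⟨Finset.Icc (-1) (Q 0 + 1), ?_, fun x hx => ⟨round ((Q 0 : ℝ) * x), ?_, near x hx 0⟩⟩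
    · have : ((Q 0 : ℤ) + 1 + 1 - -1).toNat = Q 0 + 3 := by omega
      rw [Int.card_Icc, this]
      simp [growthProd]
    · obtain ⟨h0, h1⟩ := hF hx
      have h2 := abs_le.1 (abs_sub_round ((Q 0 : ℝ) * x))
      have h3 : (0 : ℝ) ≤ Q 0 * x := by have := hpos 0; positivity
      have h4 : (Q 0 : ℝ) * x ≤ Q 0 := mul_le_of_le_one_right (hpos 0).le h1
      rw [Finset.mem_Icc]
      constructor
      · have : (-1 : ℝ) ≤ round ((Q 0 : ℝ) * x) := by linarith
        exact_mod_cast this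
      · have : (round ((Q 0 : ℝ) * x) : ℝ) ≤ Q 0 + 1 := by linarith
        exact_mod_cast this
  | succ J ih =>
    obtain ⟨A, hA, hAF⟩ := ih
    set l := (Q J : ℝ) ^ (-1 - t) with hl
    set l' := (Q (J + 1) : ℝ) ^ (-1 - t) with hl'
    have hq' := hpos (J + 1)
    have hl0 : 0 < l := Real.rpow_pos_of_pos (hpos J) _
    have hl'0 : 0 < l' := Real.rpow_pos_of_pos hq' _
    have hql' : (Q (J + 1) : ℝ) * l' ≤ 1 := by
      have h2 : (1 : ℝ) ≤ Q (J + 1) := by exact_mod_cast (by have := hQ (J + 1); omega)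
      calc (Q (J + 1) : ℝ) * l' = (Q (J + 1) : ℝ) ^ (-t) := by
            rw [hl', show -1 - t = -t + -1 by ring, Real.rpow_add hq', Real.rpow_neg_one]
            field_simp
        _ ≤ 1 := Real.rpow_le_one_of_one_le_of_nonpos h2 (by linarith)
    refine ⟨A.biUnion fun p => Finset.Icc ⌈(Q (J + 1) : ℝ) * ((p : ℝ) / Q J - l - l')⌉
      ⌊(Q (J + 1) : ℝ) * ((p : ℝ) / Q J + l + l')⌋, ?_, fun x hx => ?_⟩
    · have hcard : ∀ p ∈ A, (Finset.Icc ⌈(Q (J + 1) : ℝ) * ((p : ℝ) / Q J - l - l')⌉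
          ⌊(Q (J + 1) : ℝ) * ((p : ℝ) / Q J + l + l')⌋).card ≤ ⌊5 * ((Q (J + 1) : ℝ) * l)⌋₊ := by
        intro p _
        rw [Int.card_Icc]
        refine Int.toNat_le.2 ?_
        rw [Int.natCast_floor_eq_floor (by positivity)]
        rw [Int.le_floor]
        push_cast
        have h1 := Int.floor_le ((Q (J + 1) : ℝ) * ((p : ℝ) / Q J + l + l'))
        have h2 := Int.le_ceil ((Q (J + 1) : ℝ) * ((p : ℝ) / Q J - l - l'))
        have h3 := hg J
        rw [← hl] at h3
        nlinarith
      have h1 := Finset.card_biUnion_le_card_mul _ _ _ hcard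
      rw [growthProd_succ, ← hl, ← mul_assoc]
      calc _ ≤ ((A.card * ⌊5 * ((Q (J + 1) : ℝ) * l)⌋₊ : ℕ) : ℝ) := by exact_mod_cast h1
        _ = (A.card : ℝ) * (⌊5 * ((Q (J + 1) : ℝ) * l)⌋₊ : ℝ) := by push_cast; rfl
        _ ≤ _ := mul_le_mul hA (Nat.floor_le (by positivity)) (by positivity)
          (le_trans (by positivity) hA)
    · obtain ⟨p, hp, hxp⟩ := hAF x hx
      refine ⟨round ((Q (J + 1) : ℝ) * x), ?_, near x hx (J + 1)⟩
      have h2 := near x hx (J + 1)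
      rw [← hl'] at h2
      rw [abs_le] at hxp h2
      have h3 : (round ((Q (J + 1) : ℝ) * x) : ℝ) =
        Q (J + 1) * ((round ((Q (J + 1) : ℝ) * x) : ℝ) / Q (J + 1)) := by field_simp
      rw [Finset.mem_biUnion]
      refine ⟨p, hp, Finset.mem_Icc.2 ⟨Int.ceil_le.2 ?_, Int.le_floor.2 ?_⟩⟩
      · rw [h3]
        exact mul_le_mul_of_nonneg_left (by linarith) hq'.le
      · rw [h3]
        exact mul_le_mul_of_nonneg_left (by linarith) hq'.le

theorem exists_finset_closedBall_subset (a : ℝ) {l R : ℝ} (hl : 0 ≤ l) (hR : 0 < R) :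
    ∃ C : Finset ℝ, (C.card : ℝ) ≤ 2 * max 1 (l / R) ∧
      Metric.closedBall a l ⊆ ⋃ c ∈ C, Metric.closedBall c R := by
  classical
  refine ⟨(Finset.range (⌊l / R⌋₊ + 1)).image fun m : ℕ => a - l + (2 * m + 1) * R, ?_, ?_⟩
  · have h1 : ((Finset.range (⌊l / R⌋₊ + 1)).image
        fun m : ℕ => a - l + (2 * m + 1) * R).card ≤ ⌊l / R⌋₊ + 1 :=
      Finset.card_image_le.trans (Finset.card_range _).le
    have h2 := Nat.floor_le (show 0 ≤ l / R by positivity)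
    calc _ ≤ (⌊l / R⌋₊ : ℝ) + 1 := by exact_mod_cast h1
      _ ≤ _ := by linarith [le_max_left 1 (l / R), le_max_right 1 (l / R)]
  · intro x hx
    rw [Real.closedBall_eq_Icc] at hx
    obtain ⟨h1, h2⟩ := hx
    have h0 : 0 ≤ (x - a + l) / (2 * R) := div_nonneg (by linarith) (by linarith)
    simp only [Finset.mem_image, Set.iUnion_exists, Set.biUnion_and', Set.iUnion_iUnion_eq_right,
      Set.mem_iUnion, Finset.mem_range, exists_prop]
    refine ⟨⌊(x - a + l) / (2 * R)⌋₊, Nat.lt_succ_of_le (Nat.floor_le_floor ?_), ?_⟩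
    · rw [div_le_div_iff₀ (by positivity) hR]
      nlinarith
    · have h3 := Nat.floor_le h0
      have h4 := Nat.lt_floor_add_one ((x - a + l) / (2 * R))
      rw [le_div_iff₀ (by positivity)] at h3
      rw [div_lt_iff₀ (by positivity)] at h4
      rw [Real.closedBall_eq_Icc]
      constructor <;> linarith

theorem exists_finset_cover_of_scale {F : Set ℝ} {Q : ℕ → ℕ} {t : ℝ} (ht : 0 < t)
    (hQ : ∀ j, 2 ≤ Q j) (hg : ∀ j, 12 ≤ (Q (j + 1) : ℝ) * (Q j : ℝ) ^ (-1 - t))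
    (hF : F ⊆ Set.Icc 0 1)
    (hFQ : ∀ x ∈ F, ∀ j, distNearestInt ((Q j : ℝ) * x) < (Q j : ℝ) ^ (-t)) (J : ℕ) {R : ℝ}
    (hR : 0 < R) :
    ∃ C : Finset ℝ, (C.card : ℝ) ≤
        (Q 0 + 3) * growthProd Q t 5 J * (2 * max 1 ((Q J : ℝ) ^ (-1 - t) / R)) ∧
      F ⊆ ⋃ c ∈ C, Metric.closedBall c R := by
  classical
  obtain ⟨A, hA, hAF⟩ := exists_finset_int_near ht hQ hg hF hFQ J
  choose C hC hCs using fun p : ℤ => exists_finset_closedBall_subset ((p : ℝ) / Q J)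
    (l := (Q J : ℝ) ^ (-1 - t)) (by positivity) hR
  refine ⟨A.biUnion C, ?_, fun x hx => ?_⟩
  · calc ((A.biUnion C).card : ℝ) ≤ ∑ p ∈ A, ((C p).card : ℝ) := by
          exact_mod_cast Finset.card_biUnion_le
      _ ≤ ∑ p ∈ A, 2 * max 1 ((Q J : ℝ) ^ (-1 - t) / R) := Finset.sum_le_sum fun p _ => hC p
      _ = A.card * (2 * max 1 ((Q J : ℝ) ^ (-1 - t) / R)) := by
          rw [Finset.sum_const, nsmul_eq_mul]
      _ ≤ _ := mul_le_mul_of_nonneg_right hA (by positivity)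
  · obtain ⟨p, hp, hxp⟩ := hAF x hx
    have := hCs p (Metric.mem_closedBall.2 (by rwa [Real.dist_eq]))
    simp only [Set.mem_iUnion, exists_prop, Finset.mem_biUnion] at this ⊢
    obtain ⟨c, hc, hxc⟩ := this
    exact ⟨c, ⟨p, hp, hc⟩, hxc⟩

/-- In the maximum norm a product of intervals of equal radius is a ball, so the coordinate covers
multiply. -/
theorem hausdorffMeasure_le_of_finset_covers {n : ℕ} {E : Set (Fin n → ℝ)} {s K : ℝ} (hs : 0 ≤ s)
    {R : ℕ → ℝ} (hR : ∀ J, 0 < R J) (hR0 : Tendsto R atTop (𝓝 0)) (C : ℕ → Fin n → Finset ℝ)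
    (hE : ∀ J, ∀ x ∈ E, ∀ i, x i ∈ ⋃ c ∈ C J i, Metric.closedBall c (R J))
    (hK : ∀ᶠ J in atTop, (∏ i, ((C J i).card : ℝ)) * (2 * R J) ^ s ≤ K) :
    μH[s] E ≤ ENNReal.ofReal K := by
  classical
  have hdiam : ∀ J (c : Fintype.piFinset (C J)),
      Metric.ediam (Metric.closedBall (c : Fin n → ℝ) (R J)) ≤ ENNReal.ofReal (2 * R J) := by
    intro J c
    refine Metric.ediam_le_of_forall_dist_le fun x hx y hy => ?_
    have := dist_triangle_right x y (c : Fin n → ℝ)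
    rw [Metric.mem_closedBall] at hx hy
    linarith
  refine (hausdorffMeasure_le_liminf_sum (l := atTop) s E (fun J => ENNReal.ofReal (2 * R J)) ?_
    (fun J (c : Fintype.piFinset (C J)) => Metric.closedBall (c : Fin n → ℝ) (R J))
    (Eventually.of_forall hdiam) (Eventually.of_forall fun J x hx => ?_)).trans ?_
  · have := ENNReal.tendsto_ofReal (hR0.const_mul 2)
    simpa using this
  · have h := hE J x hx
    simp only [Set.mem_iUnion, exists_prop] at h
    choose c hc hxc using h
    refine Set.mem_iUnion.2 ⟨⟨c, Fintype.mem_piFinset.2 hc⟩, ?_⟩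
    rw [closedBall_pi _ (hR J).le]
    exact fun i _ => hxc i
  · refine (liminf_le_liminf (v := fun _ => ENNReal.ofReal K) ?_).trans (by simp)
    filter_upwards [hK] with J hJ
    calc ∑ c : Fintype.piFinset (C J), Metric.ediam (Metric.closedBall (c : Fin n → ℝ) (R J)) ^ s
        ≤ ∑ c : Fintype.piFinset (C J), ENNReal.ofReal (2 * R J) ^ s :=
          Finset.sum_le_sum fun c _ => ENNReal.rpow_le_rpow (hdiam J c) hs
      _ = ENNReal.ofReal ((∏ i, ((C J i).card : ℝ)) * (2 * R J) ^ s) := by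
          rw [Finset.sum_const, Finset.card_univ, Fintype.card_coe, Fintype.card_piFinset,
            nsmul_eq_mul, ENNReal.ofReal_rpow_of_nonneg (by linarith [hR J]) hs,
            ENNReal.ofReal_mul (by positivity), ← Nat.cast_prod, ENNReal.ofReal_natCast]
      _ ≤ _ := ENNReal.ofReal_le_ofReal hJ

theorem dimH_le_of_forall_distNearestInt {n : ℕ} [NeZero n] {E : Set (Fin n → ℝ)} {Q : ℕ → ℕ}
    {τ : Fin n → ℝ} {k : ℝ} (hτ : ∀ i, 0 < τ i) (hk : 1 < k) (hτk : ∀ i, τ i < k - 1)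
    (hQ : ∀ j, 2 ≤ Q j)
    (hg : ∀ i j, 12 ≤ (Q (j + 1) : ℝ) * (Q j : ℝ) ^ (-1 - τ i))
    (hlim : Tendsto (fun j => Real.log (Q (j + 1)) / Real.log (Q j)) atTop (𝓝 k))
    (hE : ∀ x ∈ E, ∀ i, x i ∈ Set.Icc (0 : ℝ) 1)
    (hEQ : ∀ x ∈ E, ∀ j i, distNearestInt ((Q j : ℝ) * x i) < (Q j : ℝ) ^ (-τ i)) (l : Fin n) :
    dimH E ≤ ENNReal.ofReal
      ((∑ i, (1 - τ i / (k - 1)) + ∑ i, max (τ l - τ i) 0) / (τ l + 1)) := by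
  have hpos : ∀ j, (0 : ℝ) < Q j := fun j => by
    exact_mod_cast (by have := hQ j; omega : 0 < Q j)
  have hQt := tendsto_natCast_atTop_of_two_mul_le hQ (two_mul_le_of_growth (hτ l) hQ (hg l))
  have hl := hτ l
  have hn : (0 : ℝ) < n := by exact_mod_cast Nat.pos_of_neZero n
  set V := ∑ i, (1 - τ i / (k - 1)) + ∑ i, max (τ l - τ i) 0 with hV
  have hV0 : 0 ≤ V := by
    refine add_nonneg (Finset.sum_nonneg fun i _ => ?_)
      (Finset.sum_nonneg fun i _ => le_max_right _ _)
    rw [sub_nonneg, div_le_one (by linarith)]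
    exact (hτk i).le
  refine ENNReal.le_of_forall_pos_le_add fun ε hε _ => ?_
  have hε' : (0 : ℝ) < ε := hε
  set s : ℝ := V / (τ l + 1) + ε with hs
  have hs0 : 0 ≤ s := by positivity
  -- Chosen so that the `n` counting errors are exactly paid for by the extra `ε` in `s`: the final
  -- exponent of `Q J` is `0`.
  set η : ℝ := ε * (τ l + 1) / n with hη
  have hη0 : 0 < η := by positivity
  set R : ℕ → ℝ := fun J => (Q J : ℝ) ^ (-1 - τ l) with hRdef
  have hR : ∀ J, 0 < R J := fun J => Real.rpow_pos_of_pos (hpos J) _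
  have hR0 : Tendsto R atTop (𝓝 0) := by
    have := (tendsto_rpow_neg_atTop (show 0 < 1 + τ l by linarith)).comp hQt
    simpa [hRdef, Function.comp_def, neg_add, sub_eq_add_neg, add_comm] using this
  choose C hC hCs using fun J i => exists_finset_cover_of_scale (F := (fun x => x i) '' E) (hτ i)
    hQ (hg i) (by rintro _ ⟨x, hx, rfl⟩; exact hE x hx i)
    (by rintro _ ⟨x, hx, rfl⟩ j; exact hEQ x hx j i) J (hR J)
  have hH : μH[s] E ≤ ENNReal.ofReal ((∏ _i : Fin n, (2 * ((Q 0 : ℝ) + 3))) * 2 ^ s) := by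
    refine hausdorffMeasure_le_of_finset_covers hs0 hR hR0 C
      (fun J x hx i => hCs J i ⟨x, hx, rfl⟩) ?_
    filter_upwards [eventually_all.2 fun i => eventually_growthProd_le_rpow (t := τ i) (c := 5)
      hk (by norm_num) hη0 hQ hQt hlim] with J hJ
    have hq := hpos J
    have hq1 : (1 : ℝ) ≤ Q J := by exact_mod_cast (by have := hQ J; omega)
    have h1 : ∀ i, ((C J i).card : ℝ) ≤ 2 * ((Q 0 : ℝ) + 3) *
        (Q J : ℝ) ^ ((1 - τ i / (k - 1)) + η + max (τ l - τ i) 0) := by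
      intro i
      refine (hC J i).trans ?_
      have h2 : max 1 ((Q J : ℝ) ^ (-1 - τ i) / R J) ≤ (Q J : ℝ) ^ (max (τ l - τ i) 0) := by
        refine max_le (Real.one_le_rpow hq1 (le_max_right _ _)) ?_
        rw [hRdef, ← Real.rpow_sub hq]
        refine Real.rpow_le_rpow_of_exponent_le hq1 (le_max_of_le_left ?_)
        linarith
      rw [Real.rpow_add hq]
      calc _ ≤ ((Q 0 : ℝ) + 3) * (Q J : ℝ) ^ ((1 - τ i / (k - 1)) + η) *
            (2 * (Q J : ℝ) ^ (max (τ l - τ i) 0)) := by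
            gcongr
            exact hJ i
        _ = _ := by ring
    have h3 : (∏ i, ((C J i).card : ℝ)) ≤ (∏ _i : Fin n, (2 * ((Q 0 : ℝ) + 3))) *
        (Q J : ℝ) ^ (V + n * η) := by
      refine (Finset.prod_le_prod (fun i _ => by positivity) fun i _ => h1 i).trans_eq ?_
      rw [Finset.prod_mul_distrib, ← Real.rpow_sum_of_pos hq]
      congr 2
      rw [Finset.sum_add_distrib, Finset.sum_add_distrib, Finset.sum_const, Finset.card_univ,
        Fintype.card_fin, nsmul_eq_mul, hV]
      ring
    calc _ ≤ (∏ _i : Fin n, (2 * ((Q 0 : ℝ) + 3))) * (Q J : ℝ) ^ (V + n * η) * (2 * R J) ^ s := by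
          gcongr
      _ = (∏ _i : Fin n, (2 * ((Q 0 : ℝ) + 3))) * 2 ^ s *
          ((Q J : ℝ) ^ (V + n * η) * (Q J : ℝ) ^ ((-1 - τ l) * s)) := by
          rw [Real.mul_rpow (by norm_num) (hR J).le, Real.rpow_mul hq.le]
          ring
      _ = _ := by
          rw [← Real.rpow_add hq]
          have : V + n * η + (-1 - τ l) * s = 0 := by
            rw [hη, hs]
            field_simp
            ring
          rw [this, Real.rpow_zero, mul_one]
  lift s to NNReal using hs0 with s'
  refine (dimH_le_of_hausdorffMeasure_ne_top (hH.trans_lt ENNReal.ofReal_lt_top).ne).trans ?_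
  rw [← ENNReal.ofReal_coe_nnreal (p := s'), hs, ENNReal.ofReal_add (by positivity) hε'.le,
    ENNReal.ofReal_coe_nnreal]

/-! ### Cantor measures from independent digits -/

/-- Numerators of the rational numbers `digitNum Q M ω j / Q j` increasing to a point of a Cantor
set: the digit `ω j` selects the next numerator among those to the right of the previous point. -/
noncomputable def digitNum (Q M : ℕ → ℕ) (ω : ∀ j, Fin (M j)) : ℕ → ℕ
  | 0 => 0
  | j + 1 => ⌈(Q (j + 1) : ℝ) * ((digitNum Q M ω j : ℝ) / Q j)⌉₊ + ω j

section Digits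

variable {Q M : ℕ → ℕ} {l : ℕ → ℝ}

theorem digitNum_div_le_succ (hQ : ∀ j, 0 < Q j) (ω : ∀ j, Fin (M j)) (j : ℕ) :
    (digitNum Q M ω j : ℝ) / Q j ≤ (digitNum Q M ω (j + 1) : ℝ) / Q (j + 1) := by
  have h : (0 : ℝ) < Q (j + 1) := by exact_mod_cast hQ (j + 1)
  rw [le_div_iff₀ h, mul_comm, digitNum]
  push_cast
  linarith [Nat.le_ceil ((Q (j + 1) : ℝ) * ((digitNum Q M ω j : ℝ) / Q j)),
    (Nat.cast_nonneg (ω j : ℕ) : (0 : ℝ) ≤ (ω j : ℕ))]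

/-- The slack `2` absorbs the rounding up and the length of the child interval, each less than `1 /
Q (j + 1)`; hence the intervals are nested. -/
theorem digitNum_succ_div_add_le (hQ : ∀ j, 0 < Q j) (hl : ∀ j, (Q j : ℝ) * l j < 1)
    (hM : ∀ j, (M j : ℝ) + 2 ≤ Q (j + 1) * l j) (ω : ∀ j, Fin (M j)) (j : ℕ) :
    (digitNum Q M ω (j + 1) : ℝ) / Q (j + 1) + l (j + 1) ≤ (digitNum Q M ω j : ℝ) / Q j + l j := by
  have h : (0 : ℝ) < Q (j + 1) := by exact_mod_cast hQ (j + 1)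
  have h0 : (0 : ℝ) ≤ (Q (j + 1) : ℝ) * ((digitNum Q M ω j : ℝ) / Q j) := by positivity
  have h1 := Nat.ceil_lt_add_one h0
  have h2 : ((ω j : ℕ) : ℝ) + 1 ≤ M j := by exact_mod_cast (ω j).2
  refine le_of_mul_le_mul_left ?_ h
  rw [mul_add, mul_div_cancel₀ _ h.ne', mul_add, digitNum]
  push_cast
  linarith [hl (j + 1), hM j]

/-- The point of the Cantor set with digits `ω`. -/
noncomputable def digitPoint (Q M : ℕ → ℕ) (ω : ∀ j, Fin (M j)) : ℝ :=
  ⨆ j, (digitNum Q M ω j : ℝ) / Q j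

theorem digitPoint_mem_Icc (hQ : ∀ j, 0 < Q j) (hl0 : ∀ j, 0 ≤ l j)
    (hl : ∀ j, (Q j : ℝ) * l j < 1)
    (hM : ∀ j, (M j : ℝ) + 2 ≤ Q (j + 1) * l j) (ω : ∀ j, Fin (M j)) (j : ℕ) :
    digitPoint Q M ω ∈ Set.Icc ((digitNum Q M ω j : ℝ) / Q j)
      ((digitNum Q M ω j : ℝ) / Q j + l j) :=
  Set.mem_iInter.1 (Monotone.ciSup_mem_iInter_Icc_of_antitone
    (monotone_nat_of_le_succ (digitNum_div_le_succ hQ ω))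
    (antitone_nat_of_succ_le (digitNum_succ_div_add_le hQ hl hM ω))
    fun j => le_add_of_nonneg_right (hl0 j)) j

/-- Since `Q j * l j < 1`, a parent interval contains no second fraction with denominator `Q j`, so
the parent numerator is a floor computed from the child. A numerator thus determines its whole digit
history. -/
theorem digitNum_eq_of_succ_eq (hQ : ∀ j, 0 < Q j) (hl0 : ∀ j, 0 ≤ l j)
    (hl : ∀ j, (Q j : ℝ) * l j < 1)
    (hM : ∀ j, (M j : ℝ) + 2 ≤ Q (j + 1) * l j) {ω ω' : ∀ j, Fin (M j)} {j : ℕ}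
    (h : digitNum Q M ω (j + 1) = digitNum Q M ω' (j + 1)) :
    digitNum Q M ω j = digitNum Q M ω' j ∧ ω j = ω' j := by
  have hq : (0 : ℝ) < Q j := by exact_mod_cast hQ j
  have key : ∀ ω : ∀ j, Fin (M j),
      digitNum Q M ω j = ⌊(Q j : ℝ) * ((digitNum Q M ω (j + 1) : ℝ) / Q (j + 1))⌋₊ := by
    intro ω
    have h1 := digitNum_div_le_succ hQ ω j
    have h2 := digitNum_succ_div_add_le hQ hl hM ω j
    have h3 := hl0 (j + 1)
    rw [eq_comm, Nat.floor_eq_iff (by positivity)]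
    have h4 : (digitNum Q M ω j : ℝ) = Q j * ((digitNum Q M ω j : ℝ) / Q j) := by field_simp
    constructor
    · rw [h4]
      exact mul_le_mul_of_nonneg_left h1 hq.le
    · have h5 : (Q j : ℝ) * ((digitNum Q M ω (j + 1) : ℝ) / Q (j + 1)) ≤
          Q j * ((digitNum Q M ω j : ℝ) / Q j + l j) :=
        mul_le_mul_of_nonneg_left (by linarith) hq.le
      rw [mul_add, ← h4] at h5
      linarith [hl j]
  have h1 : digitNum Q M ω j = digitNum Q M ω' j := by rw [key ω, key ω', h]
  refine ⟨h1, Fin.ext ?_⟩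
  rw [digitNum, digitNum, h1] at h
  omega

theorem digits_eq_of_digitNum_eq (hQ : ∀ j, 0 < Q j) (hl0 : ∀ j, 0 ≤ l j)
    (hl : ∀ j, (Q j : ℝ) * l j < 1)
    (hM : ∀ j, (M j : ℝ) + 2 ≤ Q (j + 1) * l j) {ω ω' : ∀ j, Fin (M j)} {J : ℕ}
    (h : digitNum Q M ω J = digitNum Q M ω' J) : ∀ j < J, ω j = ω' j := by
  induction J with
  | zero => intro j hj; omega
  | succ J ih =>
    obtain ⟨h1, h2⟩ := digitNum_eq_of_succ_eq hQ hl0 hl hM h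
    intro j hj
    rcases Nat.lt_succ_iff_lt_or_eq.1 hj with hj | rfl
    · exact ih h1 j hj
    · exact h2

theorem measurable_digitNum (Q M : ℕ → ℕ) (j : ℕ) : Measurable fun ω => digitNum Q M ω j := by
  induction j with
  | zero => exact measurable_const
  | succ j ih =>
    simp only [digitNum]
    refine Measurable.add ?_ ?_
    · exact (measurable_from_top (f := fun p : ℕ => ⌈(Q (j + 1) : ℝ) * ((p : ℝ) / Q j)⌉₊)).comp ih
    · exact (measurable_of_countable (fun d : Fin (M j) => (d : ℕ))).comp (measurable_pi_apply j)

theorem measurable_digitPoint (Q M : ℕ → ℕ) : Measurable (digitPoint Q M) :=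
  Measurable.iSup fun j =>
    ((measurable_from_top (f := fun p : ℕ => (p : ℝ))).comp (measurable_digitNum Q M j)).div_const _

/-- The distribution of independent uniform digits. -/
noncomputable def digitMeasure (M : ℕ → ℕ) : Measure (∀ j, Fin (M j)) :=
  infinitePi fun _ => ProbabilityTheory.uniformOn Set.univ

instance isProbabilityMeasure_uniformOn_univ_fin (m : ℕ) [NeZero m] :
    IsProbabilityMeasure (ProbabilityTheory.uniformOn (Set.univ : Set (Fin m))) :=
  ProbabilityTheory.isProbabilityMeasure_uniformOn Set.finite_univ Set.univ_nonempty

theorem digitMeasure_digitNum_eq_le [∀ j, NeZero (M j)] (hQ : ∀ j, 0 < Q j) (hl0 : ∀ j, 0 ≤ l j)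
    (hl : ∀ j, (Q j : ℝ) * l j < 1)
    (hM : ∀ j, (M j : ℝ) + 2 ≤ Q (j + 1) * l j) (J v : ℕ) :
    digitMeasure M {ω | digitNum Q M ω J = v} ≤
      ENNReal.ofReal (∏ j ∈ Finset.range J, (M j : ℝ))⁻¹ := by
  rcases Set.eq_empty_or_nonempty {ω | digitNum Q M ω J = v} with h | ⟨ω₀, hω₀⟩
  · simp [h]
  · have hsub : {ω | digitNum Q M ω J = v} ⊆
        Set.pi (Finset.range J : Set ℕ) fun j => ({ω₀ j} : Set (Fin (M j))) := by
      intro ω hω j hj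
      exact digits_eq_of_digitNum_eq hQ hl0 hl hM (hω.trans hω₀.symm) j (by simpa using hj)
    refine (measure_mono hsub).trans ?_
    rw [digitMeasure, infinitePi_pi _ fun j _ => measurableSet_singleton _]
    rw [← Finset.prod_inv_distrib, ENNReal.ofReal_prod_of_nonneg fun j _ => by positivity]
    refine Finset.prod_le_prod' fun j _ => ?_
    have : (0 : ℝ) < M j := by exact_mod_cast Nat.pos_of_neZero (M j)
    rw [ProbabilityTheory.uniformOn_univ, count_singleton, Fintype.card_fin,
      ENNReal.ofReal_inv_of_pos this, ENNReal.ofReal_natCast, one_div]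

/-- A level `J` interval meeting the ball has its numerator in `[Q J * (u - r) - 1, Q J * (u + r)]`,
and each numerator carries the mass of at most one cylinder. -/
theorem digitMeasure_digitPoint_mem_closedBall_le [∀ j, NeZero (M j)] (hQ : ∀ j, 0 < Q j)
    (hl0 : ∀ j, 0 ≤ l j) (hl : ∀ j, (Q j : ℝ) * l j < 1)
    (hM : ∀ j, (M j : ℝ) + 2 ≤ Q (j + 1) * l j) (u : ℝ) {r : ℝ} (hr : 0 ≤ r) (J : ℕ) :
    digitMeasure M (digitPoint Q M ⁻¹' Metric.closedBall u r) ≤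
      ENNReal.ofReal ((2 * Q J * r + 2) / ∏ j ∈ Finset.range J, (M j : ℝ)) := by
  have hq : (0 : ℝ) < Q J := by exact_mod_cast hQ J
  set S : Finset ℤ := Finset.Icc ⌈(Q J : ℝ) * (u - r) - 1⌉ ⌊(Q J : ℝ) * (u + r)⌋ with hS
  have hcard : (S.card : ℝ) ≤ 2 * Q J * r + 2 := by
    rw [hS, Int.card_Icc]
    have h1 := Int.floor_le ((Q J : ℝ) * (u + r))
    have h2 := Int.le_ceil ((Q J : ℝ) * (u - r) - 1)
    have h3 : (0 : ℝ) ≤ Q J * r := by positivity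
    have h4 : (((⌊(Q J : ℝ) * (u + r)⌋ + 1 - ⌈(Q J : ℝ) * (u - r) - 1⌉).toNat : ℤ) : ℝ) ≤
        2 * Q J * r + 2 := by
      rw [Int.toNat_eq_max, Int.cast_max]
      refine max_le ?_ (by push_cast; linarith)
      push_cast
      linarith
    exact_mod_cast h4
  -- Negative `p` are sent to `0` by `toNat`, which only enlarges the union.
  have hsub : digitPoint Q M ⁻¹' Metric.closedBall u r ⊆
      ⋃ p ∈ S, {ω | digitNum Q M ω J = p.toNat} := by
    intro ω hω
    rw [Set.mem_preimage, Real.closedBall_eq_Icc] at hω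
    obtain ⟨h1, h2⟩ := digitPoint_mem_Icc hQ hl0 hl hM ω J
    have h4 : (digitNum Q M ω J : ℝ) = Q J * ((digitNum Q M ω J : ℝ) / Q J) := by field_simp
    simp only [Set.mem_iUnion, exists_prop]
    refine ⟨(digitNum Q M ω J : ℤ), Finset.mem_Icc.2 ⟨Int.ceil_le.2 ?_, Int.le_floor.2 ?_⟩, ?_⟩
    · have h5 : (Q J : ℝ) * (u - r) ≤ Q J * ((digitNum Q M ω J : ℝ) / Q J + l J) :=
        mul_le_mul_of_nonneg_left (by linarith [hω.1]) hq.le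
      rw [mul_add, ← h4] at h5
      push_cast
      linarith [hl J]
    · push_cast
      rw [h4]
      exact mul_le_mul_of_nonneg_left (by linarith [hω.2]) hq.le
    · simp
  have hP : 0 < ∏ j ∈ Finset.range J, (M j : ℝ) :=
    Finset.prod_pos fun j _ => by exact_mod_cast Nat.pos_of_neZero (M j)
  calc digitMeasure M (digitPoint Q M ⁻¹' Metric.closedBall u r)
      ≤ ∑ p ∈ S, digitMeasure M {ω | digitNum Q M ω J = p.toNat} :=
        (measure_mono hsub).trans (measure_biUnion_finset_le _ _)
    _ ≤ ∑ p ∈ S, ENNReal.ofReal (∏ j ∈ Finset.range J, (M j : ℝ))⁻¹ :=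
        Finset.sum_le_sum fun p _ => digitMeasure_digitNum_eq_le hQ hl0 hl hM J _
    _ = ENNReal.ofReal (S.card * (∏ j ∈ Finset.range J, (M j : ℝ))⁻¹) := by
        rw [Finset.sum_const, nsmul_eq_mul, ENNReal.ofReal_mul (by positivity),
          ENNReal.ofReal_natCast]
    _ ≤ _ := by
        rw [div_eq_mul_inv]
        gcongr

end Digits

theorem exists_cantor_measure {Q : ℕ → ℕ} {t : ℝ} (ht : 0 < t) (hQ : ∀ j, 2 ≤ Q j)
    (hg : ∀ j, 12 ≤ (Q (j + 1) : ℝ) * (Q j : ℝ) ^ (-1 - t)) :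
    ∃ μ : Measure ℝ, IsProbabilityMeasure μ ∧
      1 ≤ μ {x | x ∈ Set.Icc (0 : ℝ) 1 ∧
        ∀ j, distNearestInt ((Q j : ℝ) * x) < (Q j : ℝ) ^ (-t)} ∧
      ∀ u r : ℝ, 0 ≤ r → ∀ J, μ (Metric.closedBall u r) ≤
        ENNReal.ofReal ((2 * Q J * r + 2) / growthProd Q t (1 / 4) J) := by
  have hQ0 : ∀ j, 0 < Q j := fun j => by have := hQ j; omega
  have hpos : ∀ j, (0 : ℝ) < Q j := fun j => by exact_mod_cast hQ0 j
  have hone : ∀ j, (1 : ℝ) ≤ Q j := fun j => by exact_mod_cast hQ0 j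
  -- Half the permitted length makes the approximation strict even at the right endpoint and gives
  -- `Q j * l j < 1`.
  set l : ℕ → ℝ := fun j => (Q j : ℝ) ^ (-1 - t) / 2 with hldef
  have hl0 : ∀ j, 0 ≤ l j := fun j => by
    have := Real.rpow_pos_of_pos (hpos j) (-1 - t)
    simp only [hldef]
    positivity
  have hQl : ∀ j, (Q j : ℝ) * l j = (Q j : ℝ) ^ (-t) / 2 := by
    intro j
    simp only [hldef]
    rw [show -1 - t = -t + -1 by ring, Real.rpow_add (hpos j), Real.rpow_neg_one]
    have := (hpos j).ne'
    field_simp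
  have hl : ∀ j, (Q j : ℝ) * l j < 1 := fun j => by
    rw [hQl]
    linarith [Real.rpow_le_one_of_one_le_of_nonpos (hone j) (show -t ≤ 0 by linarith)]
  set M : ℕ → ℕ := fun j => ⌊(Q (j + 1) : ℝ) * l j⌋₊ - 2 with hMdef
  have hx : ∀ j, 6 ≤ (Q (j + 1) : ℝ) * l j := fun j => by
    have := hg j
    simp only [hldef]
    linarith
  have hfl : ∀ j, 6 ≤ ⌊(Q (j + 1) : ℝ) * l j⌋₊ := fun j => Nat.le_floor (by exact_mod_cast hx j)
  have hMcast : ∀ j, (M j : ℝ) = ⌊(Q (j + 1) : ℝ) * l j⌋₊ - 2 := fun j => by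
    have := hfl j
    simp only [hMdef]
    rw [Nat.cast_sub (by omega)]
    norm_num
  have hM : ∀ j, (M j : ℝ) + 2 ≤ Q (j + 1) * l j := fun j => by
    rw [hMcast]
    linarith [Nat.floor_le (show 0 ≤ (Q (j + 1) : ℝ) * l j by linarith [hx j])]
  -- Rounding and the slack lose less than `3`, at most half of `Q (j + 1) * l j ≥ 6`; this is what
  -- the bound `12` is for. The other half comes from `l`.
  have hMge : ∀ j, 1 / 4 * ((Q (j + 1) : ℝ) * (Q j : ℝ) ^ (-1 - t)) ≤ M j := fun j => by
    have h1 := Nat.lt_floor_add_one ((Q (j + 1) : ℝ) * l j)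
    have h2 := hx j
    rw [hMcast]
    simp only [hldef] at h1 h2 ⊢
    linarith
  have hMne : ∀ j, NeZero (M j) := fun j => ⟨by have := hfl j; simp only [hMdef]; omega⟩
  have : IsProbabilityMeasure (digitMeasure M) := by
    rw [digitMeasure]; infer_instance
  have hmeas := measurable_digitPoint Q M
  refine ⟨(digitMeasure M).map (digitPoint Q M),
    isProbabilityMeasure_map hmeas.aemeasurable, ?_, fun u r hr J => ?_⟩
  · refine le_trans ?_ (le_map_apply hmeas.aemeasurable _)
    have huniv : digitPoint Q M ⁻¹' {x | x ∈ Set.Icc (0 : ℝ) 1 ∧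
        ∀ j, distNearestInt ((Q j : ℝ) * x) < (Q j : ℝ) ^ (-t)} = Set.univ := by
      refine Set.eq_univ_of_forall fun ω => ⟨?_, fun j => ?_⟩
      · obtain ⟨h1, h2⟩ := digitPoint_mem_Icc hQ0 hl0 hl hM ω 0
        simp only [digitNum, Nat.cast_zero, zero_div, zero_add] at h1 h2
        refine ⟨h1, h2.trans ?_⟩
        nlinarith [hl 0, hone 0, hl0 0]
      · obtain ⟨h1, h2⟩ := digitPoint_mem_Icc hQ0 hl0 hl hM ω j
        have h3 := Real.rpow_pos_of_pos (hpos j) (-t)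
        have h4 : (digitNum Q M ω j : ℝ) = Q j * ((digitNum Q M ω j : ℝ) / Q j) := by
          have := (hpos j).ne'
          field_simp
        have h5 := mul_le_mul_of_nonneg_left h1 (hpos j).le
        have h6 := mul_le_mul_of_nonneg_left h2 (hpos j).le
        rw [mul_add, ← h4, hQl] at h6
        rw [← h4] at h5
        refine (round_le _ (digitNum Q M ω j : ℤ)).trans_lt ?_
        push_cast
        rw [abs_lt]
        constructor <;> linarith
    rw [huniv, measure_univ]
  · rw [map_apply hmeas Metric.isClosed_closedBall.measurableSet]
    refine (digitMeasure_digitPoint_mem_closedBall_le hQ0 hl0 hl hM u hr J).trans ?_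
    refine ENNReal.ofReal_le_ofReal (div_le_div_of_nonneg_left ?_ ?_ ?_)
    · have := hpos J
      positivity
    · exact growthProd_pos hQ t (by norm_num) J
    · refine Finset.prod_le_prod (fun j _ => ?_) fun j _ => hMge j
      have := Real.rpow_pos_of_pos (hpos j) (-1 - t)
      positivity

/-! ### Lower bound by mass distribution -/

theorem le_hausdorffMeasure_of_closedBall_le {X : Type*} [MetricSpace X] [MeasurableSpace X]
    [BorelSpace X] (μ : Measure X) {s r₀ : ℝ} (hs : 0 ≤ s) (hr₀ : 0 < r₀)
    (h : ∀ x r, 0 < r → r < r₀ → μ (Metric.closedBall x r) ≤ ENNReal.ofReal (r ^ s)) :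
    μ ≤ μH[s] := by
  refine le_hausdorffMeasure s μ (ENNReal.ofReal (r₀ / 2))
    (ENNReal.ofReal_pos.2 (half_pos hr₀)) fun U hU => ?_
  rcases U.eq_empty_or_nonempty with rfl | ⟨x, hx⟩
  · simp
  have htop : Metric.ediam U ≠ ⊤ := (hU.trans_lt ENNReal.ofReal_lt_top).ne
  set d := (Metric.ediam U).toReal with hd
  have hd0 : 0 ≤ d := ENNReal.toReal_nonneg
  have hdr : d < r₀ := by
    have := ENNReal.toReal_le_of_le_ofReal (half_pos hr₀).le hU
    linarith
  have hUd : Metric.ediam U = ENNReal.ofReal d := (ENNReal.ofReal_toReal htop).symm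
  rw [hUd, ENNReal.ofReal_rpow_of_nonneg hd0 hs]
  -- The diameter `d` may be `0`, while the hypothesis needs a positive radius; letting `r` decrease
  -- to `d` avoids this and loses no constant.
  have hlim : Tendsto (fun r : ℝ => ENNReal.ofReal (r ^ s)) (𝓝[>] d)
      (𝓝 (ENNReal.ofReal (d ^ s))) :=
    ENNReal.tendsto_ofReal
      ((Real.continuous_rpow_const hs).tendsto d |>.mono_left nhdsWithin_le_nhds)
  refine ge_of_tendsto hlim ?_
  filter_upwards [Ioo_mem_nhdsGT hdr] with r hr
  refine (measure_mono fun y hy => ?_).trans (h x r (hd0.trans_lt hr.1) hr.2)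
  have h1 : edist y x ≤ ENNReal.ofReal d := hUd ▸ Metric.edist_le_ediam_of_mem hy hx
  rw [edist_dist, ENNReal.ofReal_le_ofReal_iff hd0] at h1
  exact Metric.mem_closedBall.2 (h1.trans hr.1.le)

theorem exists_scale_between {Q : ℕ → ℕ} (hQt : Tendsto (fun j => (Q j : ℝ)) atTop atTop) {N : ℕ}
    {y : ℝ} (hy : (Q N : ℝ) ≤ y) : ∃ J ≥ N, (Q J : ℝ) ≤ y ∧ y < Q (J + 1) := by
  by_contra! h
  have hall : ∀ m, (Q (N + m) : ℝ) ≤ y := by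
    intro m
    induction m with
    | zero => exact hy
    | succ m ih => exact h (N + m) (by omega) ih
  obtain ⟨J, hJ1, hJ2⟩ := ((hQt.eventually_gt_atTop y).and (eventually_ge_atTop N)).exists
  obtain ⟨m, rfl⟩ := Nat.exists_eq_add_of_le hJ2
  exact absurd (hall m) (not_le.2 hJ1)

theorem le_dimH_of_forall_distNearestInt {n : ℕ} [NeZero n] {Q : ℕ → ℕ}
    {τ : Fin n → ℝ} {k s₀ : ℝ} (hτ : ∀ i, 0 < τ i) (hk : 1 < k)
    (hQ : ∀ j, 2 ≤ Q j)
    (hg : ∀ i j, 12 ≤ (Q (j + 1) : ℝ) * (Q j : ℝ) ^ (-1 - τ i))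
    (hlim : Tendsto (fun j => Real.log (Q (j + 1)) / Real.log (Q j)) atTop (𝓝 k))
    (hs0 : 0 ≤ s₀) (hsn : s₀ ≤ n)
    (hs : ∀ j, s₀ * (1 + τ j) ≤ ∑ i, (1 - τ i / (k - 1)) + ∑ i, max (τ j - τ i) 0) :
    ENNReal.ofReal s₀ ≤ dimH {x : Fin n → ℝ | (∀ i, x i ∈ Set.Icc (0 : ℝ) 1) ∧
      ∀ j i, distNearestInt ((Q j : ℝ) * x i) < (Q j : ℝ) ^ (-τ i)} := by
  have hpos : ∀ j, (0 : ℝ) < Q j := fun j => by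
    exact_mod_cast (by have := hQ j; omega : 0 < Q j)
  have hQt := tendsto_natCast_atTop_of_two_mul_le hQ (two_mul_le_of_growth (hτ 0) hQ (hg 0))
  have hn : (0 : ℝ) < n := by exact_mod_cast Nat.pos_of_neZero n
  choose μ hμp hμ1 hμ using fun i => exists_cantor_measure (hτ i) hQ (hg i)
  refine ENNReal.le_of_forall_nnreal_lt fun s hss => ?_
  have hss' : (s : ℝ) < s₀ := by
    rw [← ENNReal.ofReal_coe_nnreal] at hss
    exact (ENNReal.ofReal_lt_ofReal_iff_of_nonneg s.coe_nonneg).1 hss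
  -- Each coordinate spends one `η` on the count and one on the constant `16`.
  set η : ℝ := (s₀ - s) / (2 * n) with hη
  have hη0 : 0 < η := div_pos (by linarith) (by linarith)
  have h16 : ∀ᶠ J in atTop, 16 ≤ (Q J : ℝ) ^ η :=
    ((tendsto_rpow_atTop hη0).comp hQt).eventually_ge_atTop 16
  obtain ⟨N, hN⟩ := eventually_atTop.1 (h16.and
    (eventually_all.2 fun i => eventually_rpow_le_growthProd (t := τ i) (c := 1 / 4)
      hk (by norm_num) hη0 hQ hQt hlim))
  have hball : ∀ (x : Fin n → ℝ) (r : ℝ), 0 < r → r < (Q N : ℝ)⁻¹ →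
      Measure.pi μ (Metric.closedBall x r) ≤ ENNReal.ofReal (r ^ (s : ℝ)) := by
    intro x r hr hrN
    obtain ⟨J, hJN, hJ1, hJ2⟩ := exists_scale_between hQt
      (show (Q N : ℝ) ≤ r⁻¹ from ((lt_inv_comm₀ hr (hpos N)).1 hrN).le)
    obtain ⟨hJ16, hJP⟩ := hN J hJN
    have hq := hpos J
    have hq1 : (1 : ℝ) < Q J := by exact_mod_cast hQ J
    have hq' := hpos (J + 1)
    have hJ1' : Q J * r ≤ 1 := by
      rwa [le_inv_comm₀ hq hr, ← one_div, le_div_iff₀ hq, mul_comm] at hJ1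
    have hJ2' : 1 ≤ Q (J + 1) * r := by
      rw [inv_lt_iff_one_lt_mul₀ hr] at hJ2
      linarith
    set t : ℝ := -Real.logb (Q J) r - 1 with ht
    have hrt : r = (Q J : ℝ) ^ (-1 - t) := by
      rw [ht, show -1 - (-Real.logb (Q J) r - 1) = Real.logb (Q J) r by ring,
        Real.rpow_logb hq hq1.ne' hr]
    have hcoord : ∀ i, μ i (Metric.closedBall (x i) r) ≤ ENNReal.ofReal
        ((Q J : ℝ) ^ (2 * η - (1 - τ i / (k - 1)) - max (t - τ i) 0)) := by
      intro i
      have hP := growthProd_pos hQ (τ i) (c := 1 / 4) (by norm_num) J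
      have hbase : 16 / growthProd Q (τ i) (1 / 4) J ≤
          (Q J : ℝ) ^ (2 * η - (1 - τ i / (k - 1))) := by
        rw [show 2 * η - (1 - τ i / (k - 1)) = η - (1 - τ i / (k - 1) - η) by ring,
          Real.rpow_sub hq]
        gcongr
        exact hJP i
      -- For `t ≤ τ i` count at level `J`, where `2 * Q J * r + 2 ≤ 4`. Otherwise count at level `J
      -- + 1`, where `2 * Q (J + 1) * r + 2 ≤ 4 * Q (J + 1) * r`; the last factor of `growthProd`
      -- turns this into `16` times the gain `Q J ^ (-(t - τ i))`.
      rcases le_total t (τ i) with hti | hti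
      · rw [max_eq_right (by linarith), sub_zero]
        refine (hμ i (x i) r hr.le J).trans (ENNReal.ofReal_le_ofReal (le_trans ?_ hbase))
        gcongr
        linarith
      · rw [max_eq_left (by linarith), Real.rpow_sub hq _ (t - τ i)]
        refine (hμ i (x i) r hr.le (J + 1)).trans (ENNReal.ofReal_le_ofReal ?_)
        have hp := Real.rpow_pos_of_pos hq (-1 - τ i)
        have hr2 : r = (Q J : ℝ) ^ (-1 - τ i) / (Q J : ℝ) ^ (t - τ i) := by
          rw [hrt, ← Real.rpow_sub hq]
          congr 1
          ring
        calc _ ≤ (4 * Q (J + 1) * r) / growthProd Q (τ i) (1 / 4) (J + 1) := by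
              have := (growthProd_pos hQ (τ i) (c := 1 / 4) (by norm_num) (J + 1)).le
              gcongr
              linarith
          _ = 16 / growthProd Q (τ i) (1 / 4) J / (Q J : ℝ) ^ (t - τ i) := by
              rw [growthProd_succ, hr2]
              have := (Real.rpow_pos_of_pos hq (t - τ i)).ne'
              field_simp
              norm_num
          _ ≤ _ := by gcongr
    rw [closedBall_pi _ hr.le, Measure.pi_pi]
    refine (Finset.prod_le_prod' fun i _ => hcoord i).trans ?_
    rw [← ENNReal.ofReal_prod_of_nonneg fun i _ => by positivity, ← Real.rpow_sum_of_pos hq]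
    refine ENNReal.ofReal_le_ofReal ?_
    have ht0 : 0 ≤ t := by
      have h1 : (1 : ℝ) ≤ (Q J : ℝ) ^ t := by
        have h2 : (Q J : ℝ) * r = (Q J : ℝ) ^ (-t) := by
          rw [hrt, show -1 - t = -t + -1 by ring, Real.rpow_add hq, Real.rpow_neg_one]
          field_simp
        rw [h2, Real.rpow_neg hq.le] at hJ1'
        exact (inv_le_one₀ (Real.rpow_pos_of_pos hq t)).1 hJ1'
      by_contra! hneg
      exact absurd (Real.rpow_lt_one_of_one_lt_of_neg hq1 hneg) (not_lt.2 h1)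
    have hkey := mul_one_add_le_of_breakpoints (t := t) hs0 hsn hs
    rw [hrt, ← Real.rpow_mul hq.le]
    refine Real.rpow_le_rpow_of_exponent_le hq1.le ?_
    rw [Finset.sum_sub_distrib, Finset.sum_sub_distrib, Finset.sum_const, Finset.card_univ,
      Fintype.card_fin, nsmul_eq_mul]
    have hnη : (n : ℝ) * (2 * η) = s₀ - s := by
      rw [hη]
      field_simp
    rw [hnη]
    nlinarith
  refine le_dimH_of_hausdorffMeasure_ne_zero fun hzero => ?_
  have hle := le_hausdorffMeasure_of_closedBall_le (Measure.pi μ) s.2 (inv_pos.2 (hpos N)) hball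
  refine absurd ((hle _).trans_eq hzero) (not_le.2 (zero_lt_one.trans_le ?_))
  calc (1 : ENNReal) = ∏ _i : Fin n, 1 := by simp
    _ ≤ ∏ i, μ i {x | x ∈ Set.Icc (0 : ℝ) 1 ∧
        ∀ j, distNearestInt ((Q j : ℝ) * x) < (Q j : ℝ) ^ (-τ i)} :=
      Finset.prod_le_prod' fun i _ => hμ1 i
    _ = Measure.pi μ (Set.pi Set.univ fun i => {x | x ∈ Set.Icc (0 : ℝ) 1 ∧
        ∀ j, distNearestInt ((Q j : ℝ) * x) < (Q j : ℝ) ^ (-τ i)}) := (Measure.pi_pi _ _).symm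
    _ ≤ Measure.pi μ {x : Fin n → ℝ | (∀ i, x i ∈ Set.Icc (0 : ℝ) 1) ∧
        ∀ j i, distNearestInt ((Q j : ℝ) * x i) < (Q j : ℝ) ^ (-τ i)} := by
      refine measure_mono fun x hx => ?_
      exact ⟨fun i => (hx i trivial).1, fun j i => (hx i trivial).2 j⟩

/-! ### Countable stability and conclusion -/

theorem liminfApproxSet_eq_iUnion {n : ℕ} (q : ℕ → ℕ) (τ : Fin n → ℝ) (N : ℕ) :
    liminfApproxSet q τ = ⋃ m, {x : Fin n → ℝ | (∀ i, x i ∈ Set.Icc (0 : ℝ) 1) ∧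
      ∀ j i, distNearestInt ((q (N + m + j) : ℝ) * x i) < (q (N + m + j) : ℝ) ^ (-τ i)} := by
  ext x
  simp only [liminfApproxSet, Set.mem_iUnion, eventually_atTop]
  constructor
  · rintro ⟨h1, m, hm⟩
    exact ⟨m, h1, fun j => hm _ (by omega)⟩
  · rintro ⟨m, h1, hm⟩
    refine ⟨h1, N + m, fun j hj => ?_⟩
    obtain ⟨j, rfl⟩ := Nat.exists_eq_add_of_le hj
    exact hm j

theorem theorem1p2 (n : ℕ) [NeZero n] (q : ℕ → ℕ) (hq : ∀ j, 0 < q j)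
    (τ : Fin n → ℝ) (hτ : ∀ i, 0 < τ i) (k : ℝ) (hk : 1 < k)
    (hlim : Tendsto (fun j => Real.log (q (j + 1)) / Real.log (q j)) atTop (𝓝 k))
    (hτk : ∀ i, τ i < k - 1) :
    dimH (liminfApproxSet q τ) =
      ENNReal.ofReal (Finset.univ.inf' Finset.univ_nonempty fun j : Fin n =>
        ((n : ℝ) - 1 / (k - 1) * ∑ i, τ i + ∑ i with τ i < τ j, (τ j - τ i)) / (τ j + 1)) := by
  obtain ⟨N, hN⟩ := exists_growth_tail hk hq hlim hτk
  have hlimN : ∀ m, Tendsto (fun j => Real.log (q (N + m + (j + 1))) / Real.log (q (N + m + j)))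
      atTop (𝓝 k) := fun m => by
    have := (tendsto_add_atTop_iff_nat (N + m)).2 hlim
    refine this.congr fun j => ?_
    rw [show j + (N + m) + 1 = N + m + (j + 1) by omega, show j + (N + m) = N + m + j by omega]
  have hQ : ∀ m j, 2 ≤ q (N + m + j) := fun m j => by
    have := (hN (m + j)).1
    rwa [← add_assoc] at this
  have hg : ∀ m i j,
      12 ≤ (q (N + m + (j + 1)) : ℝ) * (q (N + m + j) : ℝ) ^ (-1 - τ i) := fun m i j => by
    have := (hN (m + j)).2 i
    rwa [← add_assoc, add_assoc (N + m)] at this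
  have hval : ∀ j, ((n : ℝ) - 1 / (k - 1) * ∑ i, τ i + ∑ i with τ i < τ j, (τ j - τ i)) / (τ j + 1)
      = (∑ i, (1 - τ i / (k - 1)) + ∑ i, max (τ j - τ i) 0) / (τ j + 1) := by
    intro j
    congr 2
    · rw [Finset.sum_sub_distrib, Finset.sum_const, Finset.card_univ, Fintype.card_fin,
        nsmul_eq_mul, mul_one, ← Finset.sum_div]
      ring
    · rw [Finset.sum_filter]
      refine Finset.sum_congr rfl fun i _ => ?_
      split_ifs with h
      · rw [max_eq_left (by linarith)]
      · rw [max_eq_right (by push Not at h; linarith)]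
  simp only [hval]
  rw [liminfApproxSet_eq_iUnion q τ N, dimH_iUnion]
  refine le_antisymm (iSup_le fun m => ?_) ?_
  · obtain ⟨l, _, hl⟩ := Finset.exists_mem_eq_inf' (Finset.univ_nonempty (α := Fin n)) fun j =>
      (∑ i, (1 - τ i / (k - 1)) + ∑ i, max (τ j - τ i) 0) / (τ j + 1)
    rw [hl]
    exact dimH_le_of_forall_distNearestInt (Q := fun j => q (N + m + j)) hτ hk hτk (hQ m) (hg m)
      (hlimN m) (fun x hx => hx.1) (fun x hx => hx.2) l
  · have hL : ∀ i, 0 ≤ 1 - τ i / (k - 1) := fun i => by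
      rw [sub_nonneg, div_le_one (by linarith)]
      exact (hτk i).le
    refine le_iSup_of_le 0 (le_dimH_of_forall_distNearestInt (Q := fun j => q (N + 0 + j)) hτ hk
      (hQ 0) (hg 0) (hlimN 0) ?_ ?_ fun j => ?_)
    · refine Finset.le_inf' _ _ fun j _ => ?_
      have := hτ j
      exact div_nonneg (add_nonneg (Finset.sum_nonneg fun i _ => hL i)
        (Finset.sum_nonneg fun i _ => le_max_right _ _)) (by linarith)
    -- Any single index shows that the minimum is at most `n`: each summand is at most `1 + τ 0`.
    · refine (Finset.inf'_le _ (Finset.mem_univ 0)).trans ?_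
      have h0 := hτ 0
      rw [div_le_iff₀ (by linarith), ← Finset.sum_add_distrib]
      calc _ ≤ ∑ _i : Fin n, (τ 0 + 1) := by
            refine Finset.sum_le_sum fun i _ => ?_
            have h1 : 0 ≤ τ i / (k - 1) := div_nonneg (hτ i).le (by linarith)
            have h2 : max (τ 0 - τ i) 0 ≤ τ 0 := max_le (by linarith [hτ i]) h0.le
            linarith
        _ = _ := by
            rw [Finset.sum_const, Finset.card_univ, Fintype.card_fin, nsmul_eq_mul]
    · have h0 := hτ j
      rw [add_comm 1, ← le_div_iff₀ (by linarith)]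
      exact Finset.inf'_le _ (Finset.mem_univ j)
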